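/- Let $\mathbb K\in\{\mathbb R,\mathbb C\}$, $\Psi,\widetilde\Psi\in\mathbb K^{m\times n}$, let $x^\star\in\mathbb K^n$ be $s$-sparse (at most $s$ nonzero entries), $z\in\mathbb K^m$ and $y=\Psi x^\star+z$; $\|\cdot\|$ is the Euclidean norm. **Constants.** $\delta_s(A)$ is the smallest $\delta\ge 0$ with $(1-\delta)\|x\|^2\le\|Ax\|^2\le(1+\delta)\|x\|^2$ for all $s$-sparse $x$. For $M\in\mathbb K^{n\times n}$, $\theta_s(M)$ is the smallest $\delta\ge 0$ with $|\langle y,Mx\rangle-\langle y,x\rangle|\le\delta\|x\|\|y\|$ for all $x,y$ supported in a common index set with at most $s$ elements. **Operations.** $H_s(v)$ denotes a minimizer of $\|v-w\|$ over $s$-sparse $w$. For $J\subset[n]$, $\mathrm{LS}(J)$ denotes a minimizer of $\|\widetilde\Psi_J^*(y-\Psi x)\|$ over $x$ with $\operatorname{supp}x\subset J$, where $\widetilde\Psi_J$ consists of the columns of $\widetilde\Psi$ indexed by $J$. If minimizers are not unique, any choice is allowed. Write $p_t=\widetilde\Psi^*(y-\Psi x_t)$. **Algorithms.** The iterations $x_t\mapsto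 x_{t+1}$, $t\ge 0$, are: * ObSP: $\widetilde J=\operatorname{supp}x_t\cup\operatorname{supp}H_s(p_t)$, $\tilde x=\mathrm{LS}(\widetilde J)$, $J=\operatorname{supp}H_s(\tilde x)$, $x_{t+1}=\mathrm{LS}(J)$. * ObCoSaMP: $\widetilde J=\operatorname{supp}x_t\cup\operatorname{supp}H_{2s}(p_t)$, $\tilde x=\mathrm{LS}(\widetilde J)$, $x_{t+1}=H_s(\tilde x)$. * ObIHT: $x_{t+1}=H_s(x_t+p_t)$. * ObHTP: $J=\operatorname{supp}H_s(x_t+p_t)$, $x_{t+1}=\mathrm{LS}(J)$. The starting vector $x_0$ is any $s$-sparse vector for ObCoSaMP, ObIHT and ObHTP, and any $\mathrm{LS}(J_0)$ with $|J_0|\le s$ for ObSP; in particular $x_0=0$ is allowed for all four. **Claim.** Put $\theta=\theta_{4s}(\widetilde\Psi^*\Psi)$ for ObCoSaMP and $\theta=\theta_{3s}(\widetilde\Psi^*\Psi)$ for the other three algorithms. Assume $\theta<1$ (for ObIHT no assumption on $\theta$ is needed). Then for all $t\ge 0$ $$\|x_{t+1}-x^\star\|\le\rho\,\|x_t-x^\star\|+\tau\,\|z\|,$$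 where $\rho$ and $\tau$ are as follows. * ObSP: with $\mu=\max\left\{\frac1{(1-\theta)^2},\frac2{1+2\theta+2\theta^2}\right\}$, $$\rho=\frac{\theta\sqrt{1+\theta}}{\sqrt{1-\theta}}\,\mu,\qquad \tau=\frac{\sqrt{1+\delta_{2s}(\widetilde\Psi)}}{1-\theta}+\frac{\sqrt{1+\delta_{2s}(\widetilde\Psi)}}{(1-\theta)\sqrt{1-\theta^2}}+\frac{2\sqrt{1+\delta_s(\Psi)}\,(1+\delta_{2s}(\widetilde\Psi))\sqrt{1+\theta}}{\sqrt{1-\theta}\,(1-\theta)}\,\mu.$$ * ObCoSaMP: $$\rho=\sqrt{\frac{4\theta^2(1+3\theta^2)}{1-\theta^2}},\qquad \tau=\left(\sqrt{\frac{2(1+3\theta^2)}{1-\theta^2}}+\frac{\sqrt{1+3\theta^2}}{1-\theta}+\sqrt3\right)\sqrt{1+\delta_{4s}(\widetilde\Psi)}.$$ * ObIHT: $\rho=2\theta$ and $\tau=2\sqrt{1+\delta_{2s}(\widetilde\Psi)}$. * ObHTP: $$\rho=\sqrt{\frac{2\theta^2}{1-\theta^2}},\qquad \tau=\left(\sqrt{\frac2{1-\theta^2}}+\frac1{1-\theta}\right)\sqrt{1+\delta_{2s}(\widetilde\Psi)}.$$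 Here $\rho\ge0$, with $\rho>0$ unless $\theta=0$, and $\tau>0$. Moreover $\rho<1$ whenever $\theta_{4s}(\widetilde\Psi^*\Psi)<0.384$ (ObCoSaMP), $\theta_{3s}(\widetilde\Psi^*\Psi)<0.325$ (ObSP), $\theta_{3s}(\widetilde\Psi^*\Psi)<0.5$ (ObIHT), $\theta_{3s}(\widetilde\Psi^*\Psi)<0.577$ (ObHTP). -/

import Mathlib

namespace ObliquePursuit

noncomputable section

/-- The support of a vector. -/
def supp {𝕜 : Type*} [RCLike 𝕜] {n : ℕ} (x : EuclideanSpace 𝕜 (Fin n)) : Finset (Fin n) :=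
  open Classical in Finset.univ.filter (fun i => x i ≠ 0)

/-- `x` has at most `s` nonzero entries. -/
def IsSparse {𝕜 : Type*} [RCLike 𝕜] {n : ℕ} (s : ℕ) (x : EuclideanSpace 𝕜 (Fin n)) : Prop :=
  (supp x).card ≤ s

/-- The matrix `A` acting on column vectors, between Euclidean spaces. -/
def act {𝕜 : Type*} [RCLike 𝕜] {ι κ : Type*} [Fintype ι] [Fintype κ] [DecidableEq κ]
    (A : Matrix ι κ 𝕜) (x : EuclideanSpace 𝕜 κ) : EuclideanSpace 𝕜 ι :=
  Matrix.toEuclideanLin A x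

/-- The submatrix of `A` formed by the columns indexed by `J`. -/
def cols {𝕜 : Type*} {m n : ℕ} (A : Matrix (Fin m) (Fin n) 𝕜) (J : Finset (Fin n)) :
    Matrix (Fin m) J 𝕜 :=
  A.submatrix id (fun j => (j : Fin n))

/-- The `s`-restricted isometry constant `δ_s(A)`. -/
def ric {𝕜 : Type*} [RCLike 𝕜] {m n : ℕ} (s : ℕ) (A : Matrix (Fin m) (Fin n) 𝕜) : ℝ :=
  sInf {δ : ℝ | 0 ≤ δ ∧ ∀ x : EuclideanSpace 𝕜 (Fin n), IsSparse s x →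
    (1 - δ) * ‖x‖ ^ 2 ≤ ‖act A x‖ ^ 2 ∧ ‖act A x‖ ^ 2 ≤ (1 + δ) * ‖x‖ ^ 2}

/-- The `s`-restricted biorthogonality constant `θ_s(M)`. -/
def rboc {𝕜 : Type*} [RCLike 𝕜] {n : ℕ} (s : ℕ) (M : Matrix (Fin n) (Fin n) 𝕜) : ℝ :=
  sInf {δ : ℝ | 0 ≤ δ ∧ ∀ J : Finset (Fin n), J.card ≤ s →
    ∀ x y : EuclideanSpace 𝕜 (Fin n), supp x ⊆ J → supp y ⊆ J →
      ‖inner 𝕜 y (act M x) - inner 𝕜 y x‖ ≤ δ * ‖x‖ * ‖y‖}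

/-- `w` is a value of the hard thresholding operator `H_s` at `v`, that is, a best `s`-sparse
approximation of `v`. It need not be unique when entries of `v` have equal modulus. -/
def IsHardThreshold {𝕜 : Type*} [RCLike 𝕜] {n : ℕ} (s : ℕ)
    (v w : EuclideanSpace 𝕜 (Fin n)) : Prop :=
  IsSparse s w ∧ ∀ u : EuclideanSpace 𝕜 (Fin n), IsSparse s u → ‖v - w‖ ≤ ‖v - u‖

/-- `x` minimizes `‖Ψt_J^* (y - Ψ x)‖` among the vectors supported in `J`. -/
def IsObliqueLS {𝕜 : Type*} [RCLike 𝕜] {m n : ℕ} (Ψ Ψt : Matrix (Fin m) (Fin n) 𝕜)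
    (y : EuclideanSpace 𝕜 (Fin m)) (J : Finset (Fin n))
    (x : EuclideanSpace 𝕜 (Fin n)) : Prop :=
  supp x ⊆ J ∧ ∀ w : EuclideanSpace 𝕜 (Fin n), supp w ⊆ J →
    ‖act (cols Ψt J).conjTranspose (y - act Ψ x)‖ ≤
      ‖act (cols Ψt J).conjTranspose (y - act Ψ w)‖

/-- The proxy `Ψt^* (y - Ψ x)`. -/
def proxy {𝕜 : Type*} [RCLike 𝕜] {m n : ℕ} (Ψ Ψt : Matrix (Fin m) (Fin n) 𝕜)
    (y : EuclideanSpace 𝕜 (Fin m)) (x : EuclideanSpace 𝕜 (Fin n)) :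
    EuclideanSpace 𝕜 (Fin n) :=
  act Ψt.conjTranspose (y - act Ψ x)

/-- The four iterative oblique pursuit algorithms. -/
inductive Alg
  | ObSP
  | ObCoSaMP
  | ObIHT
  | ObHTP

/-- `Step alg s Ψ Ψt y x x'`: one iteration of `alg` at sparsity level `s` can lead from the
iterate `x` to the iterate `x'` (for some choice of the minimizers where they are not unique). -/
def Step {𝕜 : Type*} [RCLike 𝕜] {m n : ℕ} (alg : Alg) (s : ℕ)
    (Ψ Ψt : Matrix (Fin m) (Fin n) 𝕜) (y : EuclideanSpace 𝕜 (Fin m))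
    (x x' : EuclideanSpace 𝕜 (Fin n)) : Prop :=
  match alg with
  | .ObSP => ∃ h u g : EuclideanSpace 𝕜 (Fin n),
      IsHardThreshold s (proxy Ψ Ψt y x) h ∧
      IsObliqueLS Ψ Ψt y (supp x ∪ supp h) u ∧
      IsHardThreshold s u g ∧
      IsObliqueLS Ψ Ψt y (supp g) x'
  | .ObCoSaMP => ∃ h u : EuclideanSpace 𝕜 (Fin n),
      IsHardThreshold (2 * s) (proxy Ψ Ψt y x) h ∧
      IsObliqueLS Ψ Ψt y (supp x ∪ supp h) u ∧
      IsHardThreshold s u x'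
  | .ObIHT => IsHardThreshold s (x + proxy Ψ Ψt y x) x'
  | .ObHTP => ∃ g : EuclideanSpace 𝕜 (Fin n),
      IsHardThreshold s (x + proxy Ψ Ψt y x) g ∧
      IsObliqueLS Ψ Ψt y (supp g) x'

/-- Admissible starting vectors. For ObSP the start is, like every later iterate, a least squares
solution on some index set with at most `s` elements; for the other algorithms it is any `s`-sparse
vector. The zero vector is admissible in both cases. -/
def IsStart {𝕜 : Type*} [RCLike 𝕜] {m n : ℕ} (alg : Alg) (s : ℕ)
    (Ψ Ψt : Matrix (Fin m) (Fin n) 𝕜) (y : EuclideanSpace 𝕜 (Fin m))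
    (x : EuclideanSpace 𝕜 (Fin n)) : Prop :=
  match alg with
  | .ObSP => ∃ J : Finset (Fin n), J.card ≤ s ∧ IsObliqueLS Ψ Ψt y J x
  | _ => IsSparse s x

/-- `x 0, x 1, x 2, …` is a sequence generated by `alg`. -/
def IsGenerated {𝕜 : Type*} [RCLike 𝕜] {m n : ℕ} (alg : Alg) (s : ℕ)
    (Ψ Ψt : Matrix (Fin m) (Fin n) 𝕜) (y : EuclideanSpace 𝕜 (Fin m))
    (x : ℕ → EuclideanSpace 𝕜 (Fin n)) : Prop :=
  IsStart alg s Ψ Ψt y (x 0) ∧ ∀ t : ℕ, Step alg s Ψ Ψt y (x t) (x (t + 1))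

/-- The number `k` such that the guarantee of `alg` is in terms of `θ_{ks}`. -/
def order : Alg → ℕ
  | .ObSP => 3
  | .ObCoSaMP => 4
  | .ObIHT => 3
  | .ObHTP => 3

/-- The constant `θ_{ks}(Ψt^* Ψ)` relevant to `alg`. -/
def theta {𝕜 : Type*} [RCLike 𝕜] {m n : ℕ} (alg : Alg) (s : ℕ)
    (Ψ Ψt : Matrix (Fin m) (Fin n) 𝕜) : ℝ :=
  rboc (order alg * s) (Ψt.conjTranspose * Ψ)

/-- The threshold on `θ_{ks}(Ψt^* Ψ)` for linear convergence. -/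
def threshold : Alg → ℝ
  | .ObSP => 0.325
  | .ObCoSaMP => 0.384
  | .ObIHT => 0.5
  | .ObHTP => 0.577

/-- The contraction factor `ρ` as a function of `θ = θ_{ks}(Ψt^* Ψ)`. -/
def rho (alg : Alg) (θ : ℝ) : ℝ :=
  match alg with
  | .ObSP => θ * √(1 + θ) / √(1 - θ) *
      max (1 / (1 - θ) ^ 2) (2 / (1 + 2 * θ + 2 * θ ^ 2))
  | .ObCoSaMP => √(4 * θ ^ 2 * (1 + 3 * θ ^ 2) / (1 - θ ^ 2))
  | .ObIHT => 2 * θ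
  | .ObHTP => √(2 * θ ^ 2 / (1 - θ ^ 2))

/-- The noise amplification factor `τ`. -/
def tau {𝕜 : Type*} [RCLike 𝕜] {m n : ℕ} (alg : Alg) (s : ℕ)
    (Ψ Ψt : Matrix (Fin m) (Fin n) 𝕜) : ℝ :=
  let θ := theta alg s Ψ Ψt
  match alg with
  | .ObSP =>
      √(1 + ric (2 * s) Ψt) / (1 - θ)
      + √(1 + ric (2 * s) Ψt) / ((1 - θ) * √(1 - θ ^ 2))
      + 2 * √(1 + ric s Ψ) * (1 + ric (2 * s) Ψt) * √(1 + θ) / (√(1 - θ) * (1 - θ)) *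
        max (1 / (1 - θ) ^ 2) (2 / (1 + 2 * θ + 2 * θ ^ 2))
  | .ObCoSaMP =>
      (√(2 * (1 + 3 * θ ^ 2) / (1 - θ ^ 2)) + √(1 + 3 * θ ^ 2) / (1 - θ) + √3) *
        √(1 + ric (4 * s) Ψt)
  | .ObIHT => 2 * √(1 + ric (2 * s) Ψt)
  | .ObHTP => (√(2 / (1 - θ ^ 2)) + 1 / (1 - θ)) * √(1 + ric (2 * s) Ψt)

end

end ObliquePursuit

/-!
Write `e = x_t - x⋆`, `M = Ψt^* Ψ`, `θ` for the biorthogonality constant of `M`, `P_J` for the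
coordinate projection onto `J` (`restr J`), and `ν = √(1 + δ(Ψt)) ‖z‖`. The proxy equals
`-M e + Ψt^* z`, so seen through few coordinates it differs from `-e` by at most `θ ‖e‖ + ν`
(`norm_restr_proxy_add_le`). Three facts turn this into the four recursions.

* *Detection* (`norm_restr_missed_le`). If `T` is selected by hard thresholding from `v`, and `c`
  vanishes on `T \ K` for a competing index set `K`, then the part of `c` on `K \ T`
  is at most `√2 ‖P_{K ∪ T} (v - c)‖`, because `T \ K` carries at least the energy of `K \ T`.
* *Oblique least squares* (`IsObliqueLS.error_le`). For `θ < 1` the compression of `M` to `J` is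
  invertible, so the least squares residual is zero. Hence the error `a` of the solution and its
  part `d` inside `J` satisfy `d ≤ θ a + ν` and `a² = d² + ‖P_{Jᶜ} x⋆‖²`, and solving the quadratic
  inequality gives `a ≤ ‖P_{Jᶜ} x⋆‖ / √(1 - θ²) + ν / (1 - θ)`.
* *Pruning* (`norm_restr_compl_sq_le_of_isHardThreshold`). Thresholding a vector `u` supported in
  `U` loses a part of `x⋆` of squared norm at most `‖P_{Uᶜ} x⋆‖² + 2 ‖P_U (u - x⋆)‖²`.

ObIHT needs only the proxy estimate, ObHTP is detection followed by least squares, ObCoSaMP is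
detection, least squares and pruning, and ObSP adds one more least squares solve. For ObSP one also
uses that the current iterate is itself a least squares solution, so that the proxy vanishes on its
support and the newly selected indices are disjoint from it; this is what lets detection compete
against `supp x⋆` alone, with `s` selected indices instead of `2 s`. The factor obtained for ObSP
is `√2 θ √(1 + θ²) / (1 - θ²)`, at most the stated `ρ` (`sqrt_two_mul_sqrt_le`); the one for
ObCoSaMP is the stated `ρ` divided by `√2`.
-/

namespace ObliquePursuit

/-! ### Coordinate projections -/

section Projection

variable {𝕜 : Type*} [RCLike 𝕜] {n : ℕ}

/-- The coordinate projection onto `J`: the entries of `x` outside `J` are set to zero. -/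
noncomputable def restr (J : Finset (Fin n)) :
    EuclideanSpace 𝕜 (Fin n) →ₗ[𝕜] EuclideanSpace 𝕜 (Fin n) where
  toFun x := WithLp.toLp 2 (fun i => if i ∈ J then x i else 0)
  map_add' x y := by ext i; by_cases h : i ∈ J <;> simp [h]
  map_smul' c x := by ext i; by_cases h : i ∈ J <;> simp [h]

@[simp] lemma restr_apply (J : Finset (Fin n)) (x : EuclideanSpace 𝕜 (Fin n)) (i : Fin n) :
    restr J x i = if i ∈ J then x i else 0 := rfl

lemma mem_supp {x : EuclideanSpace 𝕜 (Fin n)} {i : Fin n} : i ∈ supp x ↔ x i ≠ 0 := by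
  simp [supp]

lemma apply_eq_zero_of_supp_subset {x : EuclideanSpace 𝕜 (Fin n)} {J : Finset (Fin n)}
    (h : supp x ⊆ J) {i : Fin n} (hi : i ∉ J) : x i = 0 := by
  by_contra hx
  exact hi (h (mem_supp.2 hx))

lemma supp_subset_iff {x : EuclideanSpace 𝕜 (Fin n)} {J : Finset (Fin n)} :
    supp x ⊆ J ↔ ∀ i, i ∉ J → x i = 0 :=
  ⟨fun h _ hi => apply_eq_zero_of_supp_subset h hi, fun h i hi => by
    by_contra hJ
    exact mem_supp.1 hi (h i hJ)⟩

lemma restr_of_supp_subset {x : EuclideanSpace 𝕜 (Fin n)} {J : Finset (Fin n)}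
    (h : supp x ⊆ J) : restr J x = x := by
  ext i
  by_cases hi : i ∈ J
  · simp [hi]
  · simp [hi, apply_eq_zero_of_supp_subset h hi]

lemma supp_restr_subset (J : Finset (Fin n)) (x : EuclideanSpace 𝕜 (Fin n)) :
    supp (restr J x) ⊆ J :=
  supp_subset_iff.2 fun i hi => by simp [hi]

lemma supp_sub_subset (x y : EuclideanSpace 𝕜 (Fin n)) : supp (x - y) ⊆ supp x ∪ supp y :=
  supp_subset_iff.2 fun i hi => by
    simp only [Finset.mem_union, mem_supp, not_or, not_not] at hi
    simp [hi.1, hi.2]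

lemma restr_restr (J : Finset (Fin n)) (x : EuclideanSpace 𝕜 (Fin n)) :
    restr J (restr J x) = restr J x :=
  restr_of_supp_subset (supp_restr_subset J x)

lemma norm_restr_sq (J : Finset (Fin n)) (x : EuclideanSpace 𝕜 (Fin n)) :
    ‖restr J x‖ ^ 2 = ∑ i ∈ J, ‖x i‖ ^ 2 := by
  rw [EuclideanSpace.norm_sq_eq, ← Finset.sum_subset (Finset.subset_univ J)]
  · exact Finset.sum_congr rfl fun i hi => by simp [hi]
  · intro i _ hi
    simp [hi]

lemma norm_restr_congr {J : Finset (Fin n)} {x y : EuclideanSpace 𝕜 (Fin n)}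
    (h : ∀ i ∈ J, x i = y i) : ‖restr J x‖ = ‖restr J y‖ := by
  congr 1
  ext i
  by_cases hi : i ∈ J
  · simp [hi, h i hi]
  · simp [hi]

lemma norm_restr_mono {J K : Finset (Fin n)} (h : J ⊆ K) (x : EuclideanSpace 𝕜 (Fin n)) :
    ‖restr J x‖ ≤ ‖restr K x‖ := by
  refine le_of_sq_le_sq ?_ (norm_nonneg _)
  rw [norm_restr_sq, norm_restr_sq]
  exact Finset.sum_le_sum_of_subset_of_nonneg h fun _ _ _ => by positivity

/-- Comparison of projections of two vectors: only the nonzero entries of the first matter. -/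
lemma norm_restr_le_restr {A B : Finset (Fin n)} {x y : EuclideanSpace 𝕜 (Fin n)}
    (h : ∀ i ∈ A, x i ≠ 0 → i ∈ B ∧ x i = y i) : ‖restr A x‖ ≤ ‖restr B y‖ := by
  refine le_of_sq_le_sq ?_ (norm_nonneg _)
  rw [EuclideanSpace.norm_sq_eq, EuclideanSpace.norm_sq_eq]
  refine Finset.sum_le_sum fun i _ => ?_
  by_cases hi : i ∈ A ∧ x i ≠ 0
  · obtain ⟨h1, h2⟩ := h i hi.1 hi.2
    simp [hi.1, h1, h2]
  · have : restr A x i = 0 := by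
      rw [restr_apply]
      split_ifs with hA
      · by_contra hx
        exact hi ⟨hA, hx⟩
      · rfl
    rw [this, norm_zero, zero_pow two_ne_zero]
    positivity

lemma norm_restr_union_sq {J K : Finset (Fin n)} (h : Disjoint J K)
    (x : EuclideanSpace 𝕜 (Fin n)) :
    ‖restr (J ∪ K) x‖ ^ 2 = ‖restr J x‖ ^ 2 + ‖restr K x‖ ^ 2 := by
  simp only [norm_restr_sq, Finset.sum_union h]

lemma norm_sq_eq_restr_add_compl (J : Finset (Fin n)) (x : EuclideanSpace 𝕜 (Fin n)) :
    ‖x‖ ^ 2 = ‖restr J x‖ ^ 2 + ‖restr Jᶜ x‖ ^ 2 := by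
  rw [← norm_restr_union_sq disjoint_compl_right, Finset.union_compl,
    restr_of_supp_subset (Finset.subset_univ _)]

lemma norm_restr_le (J : Finset (Fin n)) (x : EuclideanSpace 𝕜 (Fin n)) :
    ‖restr J x‖ ≤ ‖x‖ := by
  simpa [restr_of_supp_subset (Finset.subset_univ (supp x))] using
    norm_restr_mono (Finset.subset_univ J) x

lemma norm_restr_add_le_sqrt_two {A B K : Finset (Fin n)} (hAB : Disjoint A B)
    (hK : A ∪ B ⊆ K) (x : EuclideanSpace 𝕜 (Fin n)) :
    ‖restr A x‖ + ‖restr B x‖ ≤ √2 * ‖restr K x‖ := by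
  refine le_trans ?_ (mul_le_mul_of_nonneg_left (norm_restr_mono hK x) (Real.sqrt_nonneg 2))
  refine abs_le_of_sq_le_sq' ?_ (by positivity) |>.2
  rw [mul_pow, Real.sq_sqrt (by norm_num), norm_restr_union_sq hAB]
  nlinarith [sq_nonneg (‖restr A x‖ - ‖restr B x‖)]

lemma inner_restr_left (J : Finset (Fin n)) (x y : EuclideanSpace 𝕜 (Fin n)) :
    inner 𝕜 (restr J x) y = inner 𝕜 x (restr J y) := by
  simp only [PiLp.inner_apply]
  exact Finset.sum_congr rfl fun i _ => by by_cases h : i ∈ J <;> simp [h]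

lemma norm_restr_sq_eq_inner (J : Finset (Fin n)) (x : EuclideanSpace 𝕜 (Fin n)) :
    ‖restr J x‖ ^ 2 = ‖inner 𝕜 (restr J x) x‖ := by
  rw [← restr_restr, inner_restr_left, restr_restr, inner_self_eq_norm_sq_to_K]
  simp

end Projection

/-! ### Restricted isometry and biorthogonality constants -/

section Constants

variable {𝕜 : Type*} [RCLike 𝕜] {m n : ℕ}

lemma act_eq (A : Matrix (Fin m) (Fin n) 𝕜) (x : EuclideanSpace 𝕜 (Fin n)) :
    act A x = Matrix.toEuclideanLin A x := rfl

lemma act_mul_apply (A : Matrix (Fin n) (Fin m) 𝕜) (B : Matrix (Fin m) (Fin n) 𝕜)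
    (x : EuclideanSpace 𝕜 (Fin n)) : act (A * B) x = act A (act B x) := by
  simp [act, Matrix.toLpLin_apply, Matrix.mulVec_mulVec]

lemma act_sub (A : Matrix (Fin m) (Fin n) 𝕜) (x y : EuclideanSpace 𝕜 (Fin n)) :
    act A (x - y) = act A x - act A y := map_sub _ _ _

lemma act_add (A : Matrix (Fin m) (Fin n) 𝕜) (x y : EuclideanSpace 𝕜 (Fin n)) :
    act A (x + y) = act A x + act A y := map_add _ _ _

lemma norm_act_le (A : Matrix (Fin m) (Fin n) 𝕜) :
    ∃ C : ℝ, 0 ≤ C ∧ ∀ x : EuclideanSpace 𝕜 (Fin n), ‖act A x‖ ≤ C * ‖x‖ :=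
  ⟨‖(Matrix.toEuclideanLin A).toContinuousLinearMap‖, norm_nonneg _, fun x =>
    (Matrix.toEuclideanLin A).toContinuousLinearMap.le_opNorm x⟩

lemma inner_act_conjTranspose (A : Matrix (Fin m) (Fin n) 𝕜) (x : EuclideanSpace 𝕜 (Fin n))
    (z : EuclideanSpace 𝕜 (Fin m)) :
    inner 𝕜 x (act A.conjTranspose z) = inner 𝕜 (act A x) z := by
  rw [act, Matrix.toEuclideanLin_conjTranspose_eq_adjoint, LinearMap.adjoint_inner_right]
  rfl

lemma rboc_nonneg (k : ℕ) (M : Matrix (Fin n) (Fin n) 𝕜) : 0 ≤ rboc k M :=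
  Real.sInf_nonneg fun _ h => h.1

lemma ric_nonneg (k : ℕ) (A : Matrix (Fin m) (Fin n) 𝕜) : 0 ≤ ric k A :=
  Real.sInf_nonneg fun _ h => h.1

/-- The infimum defining `θ_k(M)` is attained. -/
lemma norm_inner_sub_inner_le_rboc {k : ℕ} (M : Matrix (Fin n) (Fin n) 𝕜)
    {J : Finset (Fin n)} (hJ : J.card ≤ k) {x y : EuclideanSpace 𝕜 (Fin n)}
    (hx : supp x ⊆ J) (hy : supp y ⊆ J) :
    ‖inner 𝕜 y (act M x) - inner 𝕜 y x‖ ≤ rboc k M * ‖x‖ * ‖y‖ := by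
  rcases eq_or_ne x 0 with rfl | hx0
  · simp [act]
  rcases eq_or_ne y 0 with rfl | hy0
  · simp
  have hpos : 0 < ‖x‖ * ‖y‖ := by positivity
  rw [mul_assoc, ← div_le_iff₀ hpos]
  refine le_csInf ?_ ?_
  · obtain ⟨C, hC, h⟩ := norm_act_le M
    refine ⟨C + 1, by positivity, fun _ _ x y _ _ => ?_⟩
    calc ‖inner 𝕜 y (act M x) - inner 𝕜 y x‖
        ≤ ‖inner 𝕜 y (act M x)‖ + ‖inner 𝕜 y x‖ := norm_sub_le _ _
      _ ≤ ‖y‖ * ‖act M x‖ + ‖y‖ * ‖x‖ := add_le_add (norm_inner_le_norm _ _)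
          (norm_inner_le_norm _ _)
      _ ≤ ‖y‖ * (C * ‖x‖) + ‖y‖ * ‖x‖ := by gcongr; exact h x
      _ = (C + 1) * ‖x‖ * ‖y‖ := by ring
  · rintro δ ⟨-, hδ⟩
    rw [div_le_iff₀ hpos, ← mul_assoc]
    exact hδ J hJ x y hx hy

/-- The upper inequality in the definition of `δ_k(A)`, at the infimum itself. -/
lemma norm_act_sq_le_ric {k : ℕ} (A : Matrix (Fin m) (Fin n) 𝕜)
    {x : EuclideanSpace 𝕜 (Fin n)} (hx : IsSparse k x) :
    ‖act A x‖ ^ 2 ≤ (1 + ric k A) * ‖x‖ ^ 2 := by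
  rcases eq_or_ne x 0 with rfl | hx0
  · simp [act]
  have hpos : 0 < ‖x‖ ^ 2 := by positivity
  rw [← div_le_iff₀ hpos, ← sub_le_iff_le_add']
  refine le_csInf ?_ ?_
  · obtain ⟨C, hC, h⟩ := norm_act_le A
    refine ⟨1 + C ^ 2, by positivity, fun x _ => ⟨?_, ?_⟩⟩
    · nlinarith [sq_nonneg ‖x‖, sq_nonneg ‖act A x‖, sq_nonneg (C * ‖x‖)]
    · have := pow_le_pow_left₀ (norm_nonneg _) (h x) 2
      nlinarith [sq_nonneg ‖x‖]
  · rintro δ ⟨-, hδ⟩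
    rw [sub_le_iff_le_add', div_le_iff₀ hpos]
    exact (hδ x hx).2

/-- Restricted biorthogonality in operator form: seen through `k` coordinates, `M` is within
`θ_k(M)` of the identity. -/
lemma norm_restr_sub_act_le {k : ℕ} (M : Matrix (Fin n) (Fin n) 𝕜)
    {J K : Finset (Fin n)} (hK : K.card ≤ k) (hJ : J ⊆ K) {x : EuclideanSpace 𝕜 (Fin n)}
    (hx : supp x ⊆ K) : ‖restr J (x - act M x)‖ ≤ rboc k M * ‖x‖ := by
  set w := restr J (x - act M x) with hw
  rcases eq_or_lt_of_le (norm_nonneg w) with h0 | h0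
  · rw [← h0]
    exact mul_nonneg (rboc_nonneg _ _) (norm_nonneg _)
  have h := norm_inner_sub_inner_le_rboc M hK hx ((supp_restr_subset J (x - act M x)).trans hJ)
  rw [← inner_sub_right, ← norm_neg, ← inner_neg_right, neg_sub, ← norm_restr_sq_eq_inner,
    ← hw] at h
  nlinarith

lemma norm_restr_act_conjTranspose_le {k : ℕ} (A : Matrix (Fin m) (Fin n) 𝕜)
    {J : Finset (Fin n)} (hJ : J.card ≤ k) (z : EuclideanSpace 𝕜 (Fin m)) :
    ‖restr J (act A.conjTranspose z)‖ ≤ √(1 + ric k A) * ‖z‖ := by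
  set w := restr J (act A.conjTranspose z) with hw
  have hr := ric_nonneg k A
  rcases eq_or_lt_of_le (norm_nonneg w) with h0 | h0
  · rw [← h0]
    positivity
  have hs : ‖act A w‖ ≤ √(1 + ric k A) * ‖w‖ := by
    refine le_of_sq_le_sq ?_ (by positivity)
    rw [mul_pow, Real.sq_sqrt (by positivity)]
    exact norm_act_sq_le_ric A ((Finset.card_le_card (supp_restr_subset _ _)).trans hJ)
  have h : ‖w‖ ^ 2 ≤ ‖act A w‖ * ‖z‖ := by
    rw [hw, norm_restr_sq_eq_inner, inner_act_conjTranspose]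
    exact norm_inner_le_norm _ _
  have h' := h.trans (mul_le_mul_of_nonneg_right hs (norm_nonneg z))
  nlinarith

end Constants

/-! ### Hard thresholding and oblique least squares -/

section Operations

variable {𝕜 : Type*} [RCLike 𝕜] {m n : ℕ}

lemma IsHardThreshold.norm_sub_le_norm_restr_compl {s : ℕ} {v w : EuclideanSpace 𝕜 (Fin n)}
    (h : IsHardThreshold s v w) {K : Finset (Fin n)} (hK : K.card ≤ s) :
    ‖v - w‖ ≤ ‖restr Kᶜ v‖ := by
  refine (h.2 (restr K v) ((Finset.card_le_card (supp_restr_subset _ _)).trans hK)).trans_eq ?_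
  congr 1
  ext i
  by_cases hi : i ∈ K <;> simp [hi]

/-- Hard thresholding keeps the entries it selects unchanged. -/
lemma IsHardThreshold.eq_restr {s : ℕ} {v w : EuclideanSpace 𝕜 (Fin n)}
    (h : IsHardThreshold s v w) : w = restr (supp w) v := by
  have h1 := pow_le_pow_left₀ (norm_nonneg _) (h.norm_sub_le_norm_restr_compl h.1) 2
  rw [norm_sq_eq_restr_add_compl (supp w) (v - w),
    norm_restr_congr (J := (supp w)ᶜ) (y := v) fun i hi => by
      simp [apply_eq_zero_of_supp_subset subset_rfl (Finset.mem_compl.1 hi)]] at h1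
  have h2 : restr (supp w) (v - w) = 0 := by
    rw [← norm_eq_zero, ← sq_eq_zero_iff]
    nlinarith [sq_nonneg ‖restr (supp w) (v - w)‖]
  rw [map_sub, restr_of_supp_subset (subset_refl (supp w)), sub_eq_zero] at h2
  exact h2.symm

lemma IsHardThreshold.apply_eq {s : ℕ} {v w : EuclideanSpace 𝕜 (Fin n)}
    (h : IsHardThreshold s v w) {i : Fin n} (hi : i ∈ supp w) : w i = v i := by
  conv_lhs => rw [h.eq_restr]
  simp [hi]

lemma IsHardThreshold.supp_subset {s : ℕ} {v w : EuclideanSpace 𝕜 (Fin n)}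
    (h : IsHardThreshold s v w) : supp w ⊆ supp v := fun i hi => by
  rw [mem_supp, ← h.apply_eq hi]
  exact mem_supp.1 hi

/-- The selected entries carry at least as much energy as any competing index set. -/
lemma IsHardThreshold.norm_restr_sdiff_le {s : ℕ} {v w : EuclideanSpace 𝕜 (Fin n)}
    (h : IsHardThreshold s v w) {K : Finset (Fin n)} (hK : K.card ≤ s) :
    ‖restr (K \ supp w) v‖ ≤ ‖restr (supp w \ K) v‖ := by
  have h1 := pow_le_pow_left₀ (norm_nonneg _) (h.norm_sub_le_norm_restr_compl hK) 2
  rw [norm_sq_eq_restr_add_compl (supp w) (v - w),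
    norm_restr_congr (J := (supp w)ᶜ) (y := v) fun i hi => by
      simp [apply_eq_zero_of_supp_subset subset_rfl (Finset.mem_compl.1 hi)]] at h1
  have e1 : (supp w)ᶜ = (K \ supp w) ∪ (K ∪ supp w)ᶜ := by ext i; simp; tauto
  have e2 : Kᶜ = (supp w \ K) ∪ (K ∪ supp w)ᶜ := by ext i; simp; tauto
  rw [e1, e2, norm_restr_union_sq, norm_restr_union_sq] at h1
  · refine le_of_sq_le_sq ?_ (norm_nonneg _)
    nlinarith [sq_nonneg ‖restr (supp w) (v - w)‖]
  all_goals
    rw [Finset.disjoint_left]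
    intro i
    simp
    tauto

/-- If `T` is selected from `v` against `K`, and `c` vanishes on `T \ K`, then the part of `c` on
`K` that was missed is controlled by `v - c`. -/
lemma norm_restr_missed_le {v c : EuclideanSpace 𝕜 (Fin n)} {K T F : Finset (Fin n)}
    (h : ‖restr (K \ T) v‖ ≤ ‖restr (T \ K) v‖) (hc : ∀ i ∈ T \ K, c i = 0)
    (hF : F ⊆ K \ T) : ‖restr F c‖ ≤ √2 * ‖restr (K ∪ T) (v - c)‖ := by
  have h1 : ‖restr (T \ K) v‖ = ‖restr (T \ K) (v - c)‖ :=
    norm_restr_congr fun i hi => by simp [hc i hi]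
  have h2 : ‖restr F c‖ ≤ ‖restr F v‖ + ‖restr F (v - c)‖ := by
    have : restr F c = restr F v - restr F (v - c) := by simp
    rw [this]
    exact norm_sub_le _ _
  have h3 : ‖restr F v‖ ≤ ‖restr (K \ T) v‖ := norm_restr_mono hF v
  have h4 : ‖restr F (v - c)‖ ≤ ‖restr (K \ T) (v - c)‖ := norm_restr_mono hF _
  have h5 := norm_restr_add_le_sqrt_two (K := K ∪ T) (A := K \ T) (B := T \ K)
    disjoint_sdiff_sdiff (Finset.union_subset_union Finset.sdiff_subset Finset.sdiff_subset)
    (v - c)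
  linarith

/-- Pruning a vector `u` supported in `U` to its `s` largest entries. -/
lemma norm_restr_compl_sq_le_of_isHardThreshold {s : ℕ} {u g x : EuclideanSpace 𝕜 (Fin n)}
    {U : Finset (Fin n)} (hu : supp u ⊆ U) (hg : IsHardThreshold s u g) (hx : IsSparse s x) :
    ‖restr (supp g)ᶜ x‖ ^ 2 ≤ ‖restr Uᶜ x‖ ^ 2 + 2 * ‖restr U (u - x)‖ ^ 2 := by
  have hgU : supp g ⊆ U := hg.supp_subset.trans hu
  have hsub : (supp g)ᶜ = Uᶜ ∪ (U \ supp g) := by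
    ext i
    have := @hgU i
    simp
    tauto
  rw [hsub, norm_restr_union_sq]
  · have h1 : ‖restr (U \ supp g) x‖ ≤ ‖restr (supp x \ supp g) (restr U x)‖ :=
      norm_restr_le_restr fun i hi hxi => by
        rw [Finset.mem_sdiff] at hi
        simp [hi.1, hi.2, mem_supp.2 hxi]
    have h2 : ‖restr (supp x \ supp g) (restr U x)‖ ≤
        √2 * ‖restr (supp x ∪ supp g) (u - restr U x)‖ := by
      refine norm_restr_missed_le (hg.norm_restr_sdiff_le hx) (fun i hi => ?_) subset_rfl
      have := apply_eq_zero_of_supp_subset (subset_refl (supp x)) (Finset.mem_sdiff.1 hi).2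
      simp [this]
    have h3 : u - restr U x = restr U (u - x) := by
      rw [map_sub, restr_of_supp_subset hu]
    have h4 := norm_restr_le (supp x ∪ supp g) (restr U (u - x))
    rw [h3] at h2
    have h5 : ‖restr (U \ supp g) x‖ ≤ √2 * ‖restr U (u - x)‖ :=
      h1.trans <| h2.trans (mul_le_mul_of_nonneg_left h4 (Real.sqrt_nonneg _))
    have h6 := pow_le_pow_left₀ (norm_nonneg _) h5 2
    rw [mul_pow, Real.sq_sqrt (by norm_num)] at h6
    linarith
  · rw [Finset.disjoint_left]
    intro i
    simp
    tauto

/-- The objective of the oblique least squares problem is the norm of the projected proxy. -/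
lemma norm_act_cols_conjTranspose (A : Matrix (Fin m) (Fin n) 𝕜) (J : Finset (Fin n))
    (v : EuclideanSpace 𝕜 (Fin m)) :
    ‖act (cols A J).conjTranspose v‖ = ‖restr J (act A.conjTranspose v)‖ := by
  rw [← sq_eq_sq₀ (norm_nonneg _) (norm_nonneg _), norm_restr_sq, EuclideanSpace.norm_sq_eq,
    ← Finset.sum_coe_sort J]
  rfl

lemma proxy_eq {Ψ Ψt : Matrix (Fin m) (Fin n) 𝕜} {y z : EuclideanSpace 𝕜 (Fin m)}
    {xs : EuclideanSpace 𝕜 (Fin n)} (hy : y = act Ψ xs + z) (x : EuclideanSpace 𝕜 (Fin n)) :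
    proxy Ψ Ψt y x = act Ψt.conjTranspose z - act (Ψt.conjTranspose * Ψ) (x - xs) := by
  simp only [proxy, hy, act_mul_apply, act_sub, act_add]
  abel

/-- When `θ_k(Ψt^* Ψ) < 1`, the oblique least squares problem on at most `k` indices is solved
exactly: the compression of `Ψt^* Ψ` to these indices is injective, hence onto. -/
lemma IsObliqueLS.restr_proxy_eq_zero {k : ℕ} {Ψ Ψt : Matrix (Fin m) (Fin n) 𝕜}
    {y : EuclideanSpace 𝕜 (Fin m)} {J : Finset (Fin n)} {x : EuclideanSpace 𝕜 (Fin n)}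
    (h : IsObliqueLS Ψ Ψt y J x) (hθ : rboc k (Ψt.conjTranspose * Ψ) < 1) (hJ : J.card ≤ k) :
    restr J (proxy Ψ Ψt y x) = 0 := by
  set M := Ψt.conjTranspose * Ψ with hM
  -- the compression to `J`, made an endomorphism of the whole space by adding the identity off `J`
  let L : EuclideanSpace 𝕜 (Fin n) →ₗ[𝕜] EuclideanSpace 𝕜 (Fin n) :=
    restr J ∘ₗ Matrix.toEuclideanLin M ∘ₗ restr J + (LinearMap.id - restr J)
  have hL (w) : restr J (L w) = restr J (act M (restr J w)) := by
    simp [L, act_eq, restr_restr]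
  have hinj : Function.Injective L := by
    rw [injective_iff_map_eq_zero]
    intro w hw
    have h1 : restr J (act M (restr J w)) = 0 := by rw [← hL, hw, map_zero]
    have h2 := norm_restr_sub_act_le M hJ (subset_refl J) (supp_restr_subset J w)
    rw [map_sub, h1, sub_zero, restr_restr] at h2
    have h3 : restr J w = 0 := by
      rw [← norm_eq_zero]
      nlinarith [norm_nonneg (restr J w)]
    simpa [L, h3] using hw
  obtain ⟨w, hw⟩ := (LinearMap.injective_iff_surjective.1 hinj) (act Ψt.conjTranspose y)
  have h1 := h.2 (restr J w) (supp_restr_subset J w)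
  rw [norm_act_cols_conjTranspose, norm_act_cols_conjTranspose, act_sub _ y (act Ψ (restr J w)),
    ← act_mul_apply, map_sub, ← hM, ← hL, hw, sub_self, norm_zero] at h1
  exact norm_le_zero_iff.1 h1

/-- The quadratic inequality for the least squares error `a`, with `b` the norm of the part of the
target outside the index set and `N` the noise. -/
lemma le_of_sq_le_sq_add {θ a b N : ℝ} (h0 : 0 ≤ θ) (h1 : θ < 1) (hb : 0 ≤ b)
    (hN : 0 ≤ N) (h : a ^ 2 ≤ (θ * a + N) ^ 2 + b ^ 2) :
    a ≤ b / √(1 - θ ^ 2) + N / (1 - θ) := by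
  have hq : 0 < 1 - θ ^ 2 := by nlinarith
  set q := √(1 - θ ^ 2) with hqdef
  have hqp : 0 < q := Real.sqrt_pos.2 hq
  have hq2 : q ^ 2 = 1 - θ ^ 2 := Real.sq_sqrt hq.le
  have h1' : 0 < 1 - θ := by linarith
  -- completing the square in `a`
  have h2 : (q ^ 2 * a - θ * N) ^ 2 ≤ (N + q * b) ^ 2 := by
    have h3 : q ^ 2 * (q ^ 2 * a ^ 2 - 2 * θ * N * a - N ^ 2 - b ^ 2) ≤ 0 := by
      refine mul_nonpos_of_nonneg_of_nonpos (by positivity) ?_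
      rw [hq2]
      linarith
    have h4 : 0 ≤ N * q * b := by positivity
    have h5 : θ ^ 2 * N ^ 2 = (1 - q ^ 2) * N ^ 2 := by rw [hq2]; ring
    nlinarith
  have h6 := (abs_le_of_sq_le_sq' h2 (by positivity)).2
  have h7 : b / q + N / (1 - θ) = ((1 + θ) * N + q * b) / q ^ 2 := by
    have h8 : N / (1 - θ) = (1 + θ) * N / q ^ 2 := by
      rw [hq2]
      field_simp
      ring
    rw [h8]
    field_simp
    ring
  rw [h7, le_div_iff₀ (by positivity)]
  linarith

/-- Error of oblique least squares on `J`: the error inside `J`, and the total error in terms of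
the part of `xs` outside `J`. -/
lemma IsObliqueLS.error_le {k l : ℕ} {Ψ Ψt : Matrix (Fin m) (Fin n) 𝕜}
    {y z : EuclideanSpace 𝕜 (Fin m)} {xs x : EuclideanSpace 𝕜 (Fin n)} {J : Finset (Fin n)}
    (h : IsObliqueLS Ψ Ψt y J x) (hy : y = act Ψ xs + z)
    (hθ : rboc k (Ψt.conjTranspose * Ψ) < 1) (hJ : (J ∪ supp xs).card ≤ k) (hl : J.card ≤ l) :
    ‖restr J (x - xs)‖ ≤ rboc k (Ψt.conjTranspose * Ψ) * ‖x - xs‖ + √(1 + ric l Ψt) * ‖z‖ ∧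
    ‖x - xs‖ ^ 2 = ‖restr J (x - xs)‖ ^ 2 + ‖restr Jᶜ xs‖ ^ 2 ∧
    ‖x - xs‖ ≤ ‖restr Jᶜ xs‖ / √(1 - rboc k (Ψt.conjTranspose * Ψ) ^ 2) +
      √(1 + ric l Ψt) * ‖z‖ / (1 - rboc k (Ψt.conjTranspose * Ψ)) := by
  set M := Ψt.conjTranspose * Ψ
  have hA : ‖restr J (x - xs)‖ ≤ rboc k M * ‖x - xs‖ + √(1 + ric l Ψt) * ‖z‖ := by
    have h1 := h.restr_proxy_eq_zero hθ ((Finset.card_le_card Finset.subset_union_left).trans hJ)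
    rw [proxy_eq hy] at h1
    have h2 : restr J (x - xs) = restr J ((x - xs) - act M (x - xs)) +
        restr J (act Ψt.conjTranspose z) := by
      rw [← map_add, ← sub_eq_zero, ← map_sub, ← neg_eq_zero, ← map_neg, ← h1]
      congr 1
      abel
    calc ‖restr J (x - xs)‖ ≤ ‖restr J ((x - xs) - act M (x - xs))‖ +
          ‖restr J (act Ψt.conjTranspose z)‖ := by
          conv_lhs => rw [h2]
          exact norm_add_le _ _
      _ ≤ _ := add_le_add (norm_restr_sub_act_le M hJ Finset.subset_union_left
          ((supp_sub_subset x xs).trans (Finset.union_subset_union_left h.1)))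
          (norm_restr_act_conjTranspose_le Ψt hl z)
  have hB : ‖x - xs‖ ^ 2 = ‖restr J (x - xs)‖ ^ 2 + ‖restr Jᶜ xs‖ ^ 2 := by
    rw [norm_sq_eq_restr_add_compl J]
    congr 2
    rw [map_sub, ← norm_neg, neg_sub]
    congr 1
    ext i
    by_cases hi : i ∈ J
    · simp [hi]
    · simp [hi, apply_eq_zero_of_supp_subset h.1 hi]
  refine ⟨hA, hB, le_of_sq_le_sq_add (rboc_nonneg _ _) hθ (norm_nonneg _) (by positivity) ?_⟩
  rw [hB]
  have := pow_le_pow_left₀ (norm_nonneg _) hA 2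
  rw [← hB]
  linarith

/-- The one-step perturbation: projected to few indices, the proxy at `x` differs from `xs - x` by
at most `θ ‖x - xs‖` plus noise. -/
lemma norm_restr_proxy_add_le {k l : ℕ} {Ψ Ψt : Matrix (Fin m) (Fin n) 𝕜}
    {y z : EuclideanSpace 𝕜 (Fin m)} {xs x : EuclideanSpace 𝕜 (Fin n)} {J : Finset (Fin n)}
    (hy : y = act Ψ xs + z) (hJ : (J ∪ (supp x ∪ supp xs)).card ≤ k) (hl : J.card ≤ l) :
    ‖restr J (proxy Ψ Ψt y x + (x - xs))‖ ≤
      rboc k (Ψt.conjTranspose * Ψ) * ‖x - xs‖ + √(1 + ric l Ψt) * ‖z‖ := by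
  have h2 : proxy Ψ Ψt y x + (x - xs) = ((x - xs) - act (Ψt.conjTranspose * Ψ) (x - xs)) +
      act Ψt.conjTranspose z := by
    rw [proxy_eq hy]
    abel
  rw [h2, map_add]
  exact (norm_add_le _ _).trans (add_le_add (norm_restr_sub_act_le _ hJ Finset.subset_union_left
    ((supp_sub_subset x xs).trans Finset.subset_union_right))
    (norm_restr_act_conjTranspose_le Ψt hl z))

end Operations

/-! ### One step of each algorithm -/

section Steps

variable {𝕜 : Type*} [RCLike 𝕜] {m n : ℕ}

/-- Minkowski-type step: `√(a² + (θ a + N)²) ≤ √(1 + θ²) a + N`. -/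
lemma le_sqrt_mul_add {θ N a d c : ℝ} (hN : 0 ≤ N) (ha : 0 ≤ a) (hd : 0 ≤ d)
    (h : d ≤ θ * a + N) (hc : c ^ 2 ≤ a ^ 2 + d ^ 2) : c ≤ √(1 + θ ^ 2) * a + N := by
  have h1 : θ ≤ √(1 + θ ^ 2) := Real.le_sqrt_of_sq_le (by linarith)
  refine (abs_le_of_sq_le_sq' ?_ (by positivity)).2
  have h2 := pow_le_pow_left₀ hd h 2
  have h3 : θ * (a * N) ≤ √(1 + θ ^ 2) * (a * N) := by gcongr
  have h4 : √(1 + θ ^ 2) ^ 2 = 1 + θ ^ 2 := Real.sq_sqrt (by positivity)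
  have h5 : (√(1 + θ ^ 2) * a + N) ^ 2 =
      √(1 + θ ^ 2) ^ 2 * a ^ 2 + 2 * (√(1 + θ ^ 2) * (a * N)) + N ^ 2 := by ring
  rw [h5, h4]
  linarith

lemma le_sqrt_mul_add_sqrt_three_mul {θ N a b d c : ℝ} (hN : 0 ≤ N)
    (ha : 0 ≤ a) (hd : 0 ≤ d) (h : d ≤ θ * a + N) (hb : b ^ 2 ≤ a ^ 2)
    (hc : c ^ 2 ≤ b ^ 2 + 3 * d ^ 2) : c ≤ √(1 + 3 * θ ^ 2) * a + √3 * N := by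
  have e3 : √3 ^ 2 = 3 := Real.sq_sqrt (by norm_num)
  have h1 := le_sqrt_mul_add (θ := √3 * θ) (N := √3 * N) (a := a) (d := √3 * d) (c := c)
    (by positivity) ha (by positivity)
    (by nlinarith [mul_le_mul_of_nonneg_left h (Real.sqrt_nonneg 3)])
    (by rw [mul_pow, e3]; linarith)
  rwa [mul_pow, e3] at h1

lemma ObIHT_step_le {s : ℕ} {Ψ Ψt : Matrix (Fin m) (Fin n) 𝕜} {y z : EuclideanSpace 𝕜 (Fin m)}
    {xs x x' : EuclideanSpace 𝕜 (Fin n)} (hy : y = act Ψ xs + z) (hxs : IsSparse s xs)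
    (hx : IsSparse s x) (hstep : Step .ObIHT s Ψ Ψt y x x') :
    ‖x' - xs‖ ≤ 2 * (rboc (3 * s) (Ψt.conjTranspose * Ψ) * ‖x - xs‖ +
      √(1 + ric (2 * s) Ψt) * ‖z‖) := by
  have hstep : IsHardThreshold s (x + proxy Ψ Ψt y x) x' := hstep
  set v := x + proxy Ψ Ψt y x with hv
  set J := supp x' ∪ supp xs with hJ
  have c1 : J.card ≤ 2 * s := by
    have : J.card ≤ _ := Finset.card_union_le (supp x') (supp xs)
    have := hstep.1
    unfold IsSparse at *
    omega
  have c2 : (J ∪ (supp x ∪ supp xs)).card ≤ 3 * s := by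
    have e : J ∪ (supp x ∪ supp xs) = J ∪ supp x := by ext i; simp [hJ]; tauto
    rw [e]
    have := Finset.card_union_le J (supp x)
    unfold IsSparse at *
    omega
  have h1 := norm_restr_proxy_add_le (Ψt := Ψt) hy c2 c1
  have e1 : proxy Ψ Ψt y x + (x - xs) = v - xs := by rw [hv]; abel
  rw [e1] at h1
  -- both `x'` and `xs` live on `J`, so the comparison of distances to `v` localizes to `J`
  have h2 := pow_le_pow_left₀ (norm_nonneg _) (hstep.2 xs hxs) 2
  rw [norm_sq_eq_restr_add_compl J (v - x'), norm_sq_eq_restr_add_compl J (v - xs),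
    norm_restr_congr (J := Jᶜ) (x := v - x') (y := v - xs)] at h2
  · have h3 : ‖restr J (v - x')‖ ≤ ‖restr J (v - xs)‖ :=
      le_of_sq_le_sq (by linarith) (norm_nonneg _)
    have h4 : x' - xs = restr J (v - xs) - restr J (v - x') := by
      rw [← map_sub, sub_sub_sub_cancel_left, restr_of_supp_subset (supp_sub_subset x' xs)]
    rw [h4]
    have := norm_sub_le (restr J (v - xs)) (restr J (v - x'))
    linarith
  · intro i hi
    have hi : i ∉ supp x' ∧ i ∉ supp xs := by simpa [hJ] using hi
    simp [apply_eq_zero_of_supp_subset subset_rfl hi.1,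
      apply_eq_zero_of_supp_subset subset_rfl hi.2]

lemma ObHTP_step_le {s : ℕ} {Ψ Ψt : Matrix (Fin m) (Fin n) 𝕜} {y z : EuclideanSpace 𝕜 (Fin m)}
    {xs x x' : EuclideanSpace 𝕜 (Fin n)} (hy : y = act Ψ xs + z) (hxs : IsSparse s xs)
    (hx : IsSparse s x) (hstep : Step .ObHTP s Ψ Ψt y x x')
    {θ ν : ℝ} (hθ : θ = rboc (3 * s) (Ψt.conjTranspose * Ψ)) (hθ1 : θ < 1)
    (hν : ν = √(1 + ric (2 * s) Ψt) * ‖z‖) :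
    ‖x' - xs‖ ≤ √2 * (θ * ‖x - xs‖ + ν) / √(1 - θ ^ 2) + ν / (1 - θ) := by
  subst hθ hν
  obtain ⟨g, hg, hLS⟩ := hstep
  have hgc := hg.1
  unfold IsSparse at hgc hx hxs
  have c0 := Finset.card_union_le (supp xs) (supp g)
  have c1 : (supp xs ∪ supp g ∪ (supp x ∪ supp xs)).card ≤ 3 * s := by
    have e : supp xs ∪ supp g ∪ (supp x ∪ supp xs) = supp xs ∪ supp g ∪ supp x := by
      ext i; simp; tauto
    rw [e]
    have := Finset.card_union_le (supp xs ∪ supp g) (supp x)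
    omega
  have c2 : (supp g ∪ supp xs).card ≤ 3 * s := by
    have := Finset.card_union_le (supp g) (supp xs)
    omega
  have h1 := (hLS.error_le hy hθ1 c2 (l := 2 * s) (by omega)).2.2
  have h2 : ‖restr (supp g)ᶜ xs‖ ≤ ‖restr (supp xs \ supp g) xs‖ :=
    norm_restr_le_restr fun i hi hxi => by
      rw [Finset.mem_compl] at hi
      simp [hi, mem_supp.2 hxi]
  have h3 := norm_restr_missed_le (hg.norm_restr_sdiff_le hxs) (c := xs)
    (fun i hi => apply_eq_zero_of_supp_subset subset_rfl (Finset.mem_sdiff.1 hi).2) subset_rfl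
  have e1 : x + proxy Ψ Ψt y x - xs = proxy Ψ Ψt y x + (x - xs) := by abel
  have h4 := norm_restr_proxy_add_le (Ψt := Ψt) hy c1 (l := 2 * s) (by omega)
  rw [e1] at h3
  refine h1.trans ?_
  gcongr
  exact h2.trans (h3.trans (by gcongr))

lemma ObCoSaMP_step_le {s : ℕ} {Ψ Ψt : Matrix (Fin m) (Fin n) 𝕜}
    {y z : EuclideanSpace 𝕜 (Fin m)}
    {xs x x' : EuclideanSpace 𝕜 (Fin n)} (hy : y = act Ψ xs + z) (hxs : IsSparse s xs)
    (hx : IsSparse s x) (hstep : Step .ObCoSaMP s Ψ Ψt y x x')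
    {θ ν : ℝ} (hθ : θ = rboc (4 * s) (Ψt.conjTranspose * Ψ)) (hθ1 : θ < 1)
    (hν : ν = √(1 + ric (4 * s) Ψt) * ‖z‖) :
    ‖x' - xs‖ ≤ √(1 + 3 * θ ^ 2) *
      (√2 * (θ * ‖x - xs‖ + ν) / √(1 - θ ^ 2) + ν / (1 - θ)) + √3 * ν := by
  obtain ⟨h, u, hh, hLS, hg⟩ := hstep
  have hhc := hh.1
  have hxs' := hxs
  unfold IsSparse at hhc hx hxs
  set p := proxy Ψ Ψt y x with hp
  set U := supp x ∪ supp h with hU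
  set K := supp xs ∪ supp x with hK
  have k1 : K.card ≤ _ := Finset.card_union_le (supp xs) (supp x)
  have k2 : U.card ≤ _ := Finset.card_union_le (supp x) (supp h)
  have k3 := Finset.card_union_le U (supp xs)
  have k4 := Finset.card_union_le K (supp h)
  have c1 : (K ∪ supp h ∪ (supp x ∪ supp xs)).card ≤ 4 * s := by
    have e : K ∪ supp h ∪ (supp x ∪ supp xs) = K ∪ supp h := by ext i; simp [hK]; tauto
    rw [e]
    omega
  obtain ⟨hd, ha, hab⟩ := hLS.error_le (k := 4 * s) hy (hθ ▸ hθ1) (by omega) (l := 4 * s)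
    (by omega)
  rw [← hθ, ← hν] at hd hab
  -- the part of `xs` missed by the enlarged index set
  have hb : ‖restr Uᶜ xs‖ ≤ √2 * (θ * ‖x - xs‖ + ν) := by
    have h1 : ‖restr Uᶜ xs‖ ≤ ‖restr (K \ supp h) (xs - x)‖ :=
      norm_restr_le_restr fun i hi hxi => by
        have hi : i ∉ supp x ∧ i ∉ supp h := by simpa [hU] using hi
        simp [hK, hi.2, mem_supp.2 hxi, apply_eq_zero_of_supp_subset subset_rfl hi.1]
    have h2 := norm_restr_missed_le (hh.norm_restr_sdiff_le (K := K) (by omega)) (c := xs - x)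
      (fun i hi => by
        simp only [hK, Finset.mem_sdiff, Finset.mem_union, not_or] at hi
        simp [apply_eq_zero_of_supp_subset subset_rfl hi.2.1,
          apply_eq_zero_of_supp_subset subset_rfl hi.2.2]) subset_rfl
    have h3 := norm_restr_proxy_add_le (Ψt := Ψt) hy c1 (l := 4 * s) (by omega)
    have e1 : p - (xs - x) = p + (x - xs) := by abel
    rw [← hθ, ← hν] at h3
    rw [e1] at h2
    exact h1.trans (h2.trans (by gcongr))
  have hg1 : ‖x' - xs‖ ^ 2 ≤ ‖restr Uᶜ xs‖ ^ 2 + 3 * ‖restr U (u - xs)‖ ^ 2 := by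
    have h1 := norm_restr_compl_sq_le_of_isHardThreshold hLS.1 hg hxs'
    have h2 : ‖restr (supp x') (x' - xs)‖ ≤ ‖restr U (u - xs)‖ :=
      norm_restr_le_restr fun i hi _ =>
        ⟨hLS.1 (hg.supp_subset hi), by simp [hg.apply_eq hi]⟩
    have h3 : ‖restr (supp x')ᶜ (x' - xs)‖ ≤ ‖restr (supp x')ᶜ xs‖ := by
      rw [map_sub, norm_sub_rev, ← map_sub]
      refine norm_restr_le_restr fun i hi _ => ⟨hi, ?_⟩
      simp [apply_eq_zero_of_supp_subset subset_rfl (Finset.mem_compl.1 hi)]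
    rw [norm_sq_eq_restr_add_compl (supp x') (x' - xs)]
    have h4 := pow_le_pow_left₀ (norm_nonneg _) h2 2
    have h5 := pow_le_pow_left₀ (norm_nonneg _) h3 2
    linarith
  have hθ0 : 0 ≤ θ := hθ ▸ rboc_nonneg _ _
  have hν0 : 0 ≤ ν := hν ▸ by positivity
  have h1 : ‖x' - xs‖ ≤ √(1 + 3 * θ ^ 2) * ‖u - xs‖ + √3 * ν := by
    refine le_sqrt_mul_add_sqrt_three_mul (b := ‖restr Uᶜ xs‖) (d := ‖restr U (u - xs)‖)
      hν0 (norm_nonneg _) (norm_nonneg _) hd ?_ hg1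
    rw [ha]
    linarith [sq_nonneg ‖restr U (u - xs)‖]
  refine h1.trans ?_
  gcongr
  refine hab.trans ?_
  gcongr

/-- The hypothesis on `x` is that of a least squares solution on some `J₀`, whose support may be
smaller than `J₀`. -/
lemma ObSP_step_le {s : ℕ} {Ψ Ψt : Matrix (Fin m) (Fin n) 𝕜} {y z : EuclideanSpace 𝕜 (Fin m)}
    {xs x x' : EuclideanSpace 𝕜 (Fin n)} (hy : y = act Ψ xs + z) (hxs : IsSparse s xs)
    {θ ν : ℝ} (hθ : θ = rboc (3 * s) (Ψt.conjTranspose * Ψ)) (hθ1 : θ < 1)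
    (hν : ν = √(1 + ric (2 * s) Ψt) * ‖z‖)
    {J₀ : Finset (Fin n)} (hJ₀ : J₀.card ≤ s) (hx : IsObliqueLS Ψ Ψt y J₀ x)
    (hstep : Step .ObSP s Ψ Ψt y x x') :
    ‖x' - xs‖ ≤ (√(1 + θ ^ 2) * (√2 * (θ * ‖x - xs‖ + ν) / √(1 - θ ^ 2) + ν / (1 - θ)) + ν) /
      √(1 - θ ^ 2) + ν / (1 - θ) := by
  obtain ⟨h, u, g, hh, hLS, hg, hLS'⟩ := hstep
  have hhc := hh.1
  have hgc := hg.1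
  have hxs' := hxs
  unfold IsSparse at hhc hgc hxs
  have hxc := (Finset.card_le_card hx.1).trans hJ₀
  set p := proxy Ψ Ψt y x with hp
  set U := supp x ∪ supp h with hU
  have k2 : U.card ≤ _ := Finset.card_union_le (supp x) (supp h)
  have k3 := Finset.card_union_le U (supp xs)
  have k4 := Finset.card_union_le (supp xs) (supp h)
  have k5 := Finset.card_union_le (supp g) (supp xs)
  have c1 : (supp xs ∪ supp h ∪ (supp x ∪ supp xs)).card ≤ 3 * s := by
    have e : supp xs ∪ supp h ∪ (supp x ∪ supp xs) = U ∪ supp xs := by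
      ext i; simp [hU]; tauto
    rw [e]
    omega
  obtain ⟨hd, ha, hab⟩ := hLS.error_le (k := 3 * s) hy (hθ ▸ hθ1) (by omega) (l := 2 * s)
    (by omega)
  obtain ⟨-, -, hab'⟩ := hLS'.error_le (k := 3 * s) hy (hθ ▸ hθ1) (by omega) (l := 2 * s)
    (by omega)
  rw [← hθ, ← hν] at hd hab hab'
  have hθ0 : 0 ≤ θ := hθ ▸ rboc_nonneg _ _
  have hν0 : 0 ≤ ν := hν ▸ by positivity
  -- the proxy vanishes on `J₀`, so the newly selected indices avoid `supp x`
  have hdisj : ∀ i ∈ supp h, i ∉ supp x := by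
    intro i hi hix
    have h1 := hx.restr_proxy_eq_zero (k := 3 * s) (hθ ▸ hθ1) (by omega)
    have h2 := congrArg (fun v : EuclideanSpace 𝕜 (Fin n) => v i) h1
    simp only [restr_apply, if_pos (hx.1 hix)] at h2
    exact mem_supp.1 (hh.supp_subset hi) h2
  -- the part of `xs` missed by the enlarged index set
  have hb : ‖restr Uᶜ xs‖ ≤ √2 * (θ * ‖x - xs‖ + ν) := by
    have h1 : ‖restr Uᶜ xs‖ ≤ ‖restr (supp xs \ U) (xs - x)‖ :=
      norm_restr_le_restr fun i hi hxi => by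
        have hi : i ∉ supp x ∧ i ∉ supp h := by simpa [hU] using hi
        simp [hU, hi.1, hi.2, mem_supp.2 hxi, apply_eq_zero_of_supp_subset subset_rfl hi.1]
    have h2 := norm_restr_missed_le (hh.norm_restr_sdiff_le (K := supp xs) hxs) (c := xs - x)
      (fun i hi => by
        rw [Finset.mem_sdiff] at hi
        simp [apply_eq_zero_of_supp_subset subset_rfl hi.2,
          apply_eq_zero_of_supp_subset subset_rfl (hdisj i hi.1)])
      (Finset.sdiff_subset_sdiff subset_rfl (Finset.subset_union_right (s₁ := supp x)))
    have h3 := norm_restr_proxy_add_le (Ψt := Ψt) hy c1 (l := 2 * s) (by omega)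
    have e1 : p - (xs - x) = p + (x - xs) := by abel
    rw [← hθ, ← hν] at h3
    rw [e1] at h2
    exact h1.trans (h2.trans (by gcongr))
  have h1 : ‖restr (supp g)ᶜ xs‖ ≤ √(1 + θ ^ 2) * ‖u - xs‖ + ν := by
    refine le_sqrt_mul_add (d := ‖restr U (u - xs)‖)
      hν0 (norm_nonneg _) (norm_nonneg _) hd ?_
    rw [ha]
    linarith [norm_restr_compl_sq_le_of_isHardThreshold hLS.1 hg hxs']
  refine hab'.trans ?_
  gcongr
  refine h1.trans ?_
  gcongr
  refine hab.trans ?_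
  gcongr

end Steps

/-! ### The constants `ρ` and `τ` -/

section Constants

lemma sqrt_one_sub_sq {θ : ℝ} (h1 : θ < 1) : √(1 - θ ^ 2) = √(1 - θ) * √(1 + θ) := by
  rw [← Real.sqrt_mul (by linarith)]
  congr 1
  ring

lemma inv_one_sub_sq_le_max (θ : ℝ) :
    1 / (1 - θ) ^ 2 ≤ max (1 / (1 - θ) ^ 2) (2 / (1 + 2 * θ + 2 * θ ^ 2)) := le_max_left _ _

/-- The contraction factor obtained for `ObSP` is at most the stated one. -/
lemma sqrt_two_mul_sqrt_le {θ : ℝ} (h0 : 0 ≤ θ) (h1 : θ < 1) :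
    √2 * √(1 + θ ^ 2) ≤
      (1 + θ) * max (1 / (1 - θ) ^ 2) (2 / (1 + 2 * θ + 2 * θ ^ 2)) * √(1 - θ ^ 2) := by
  set μ := max (1 / (1 - θ) ^ 2) (2 / (1 + 2 * θ + 2 * θ ^ 2)) with hμ
  have h1' : 0 < 1 - θ := by linarith
  have hq : 0 ≤ 1 - θ ^ 2 := by nlinarith
  have hμ0 : 0 < μ := lt_of_lt_of_le (by positivity) (inv_one_sub_sq_le_max θ)
  refine (abs_le_of_sq_le_sq' ?_ (by positivity)).2
  rw [mul_pow, mul_pow, mul_pow, Real.sq_sqrt (by norm_num), Real.sq_sqrt (by positivity),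
    Real.sq_sqrt hq]
  -- the two branches of the maximum cross at `θ = 1 / 6`, where both equal `36 / 25 > √2`
  rcases le_total θ (1 / 6) with h6 | h6
  · have h2 : 36 / 25 ≤ μ := by
      refine le_trans ?_ (le_max_right _ _)
      rw [div_le_div_iff₀ (by norm_num) (by positivity)]
      nlinarith
    have h3 : 2 ≤ μ ^ 2 := by nlinarith
    have h4 : 1 + θ ^ 2 ≤ (1 + θ) ^ 2 * (1 - θ ^ 2) := by
      have : θ ^ 3 ≤ θ / 36 := by nlinarith [sq_nonneg θ]
      nlinarith [sq_nonneg θ, sq_nonneg (θ ^ 2)]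
    nlinarith [mul_nonneg (sq_nonneg (1 + θ)) hq]
  · have h2 := pow_le_pow_left₀ (by positivity) (inv_one_sub_sq_le_max θ) 2
    rw [← hμ] at h2
    have h3 : 2 * (1 + θ ^ 2) ≤ (1 + θ) ^ 2 * (1 / (1 - θ) ^ 2) ^ 2 * (1 - θ ^ 2) := by
      have e : (1 + θ) ^ 2 * (1 / (1 - θ) ^ 2) ^ 2 * (1 - θ ^ 2) =
          (1 + θ) ^ 3 / (1 - θ) ^ 3 := by
        field_simp
        ring
      rw [e, le_div_iff₀ (by positivity)]
      have h4 : (1 - θ) ^ 2 ≤ (5 / 6) ^ 2 := pow_le_pow_left₀ h1'.le (by linarith) 2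
      have h5 : 2 * (1 - θ) ^ 3 ≤ 1 + θ := by nlinarith
      have h6 : 1 + θ ^ 2 ≤ (1 + θ) ^ 2 := by nlinarith
      calc 2 * (1 + θ ^ 2) * (1 - θ) ^ 3 = (1 + θ ^ 2) * (2 * (1 - θ) ^ 3) := by ring
        _ ≤ (1 + θ) ^ 2 * (1 + θ) := by gcongr
        _ = (1 + θ) ^ 3 := by ring
    refine h3.trans ?_
    gcongr

/-- Passage from the `ObSP` one-step bound to the stated constants; `κ` absorbs the factor
`√(1 + δ_s(Ψ)) √(1 + δ_{2s}(Ψt)) / (1 - θ) ≥ 1`. -/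
lemma ObSP_constants_le {θ a ν κ : ℝ} (h0 : 0 ≤ θ) (h1 : θ < 1) (ha : 0 ≤ a) (hν : 0 ≤ ν)
    (hκ : 1 ≤ κ) :
    (√(1 + θ ^ 2) * (√2 * (θ * a + ν) / √(1 - θ ^ 2) + ν / (1 - θ)) + ν) /
        √(1 - θ ^ 2) + ν / (1 - θ) ≤
      rho .ObSP θ * a + (1 / (1 - θ) + 1 / ((1 - θ) * √(1 - θ ^ 2)) +
        2 * κ * (√(1 + θ) / √(1 - θ) *
          max (1 / (1 - θ) ^ 2) (2 / (1 + 2 * θ + 2 * θ ^ 2)))) * ν := by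
  have hA := sqrt_two_mul_sqrt_le h0 h1
  have hμ := inv_one_sub_sq_le_max θ
  simp only [rho]
  set μ := max (1 / (1 - θ) ^ 2) (2 / (1 + 2 * θ + 2 * θ ^ 2))
  set r := √(1 + θ ^ 2)
  have hq2 : 0 < 1 - θ ^ 2 := by nlinarith
  have h1' : 0 < 1 - θ := by linarith
  have hs1 : 0 < √(1 - θ) := Real.sqrt_pos.2 h1'
  have hs2 : √(1 + θ) ^ 2 = 1 + θ := Real.sq_sqrt (by linarith)
  have hqe := sqrt_one_sub_sq h1
  set q := √(1 - θ ^ 2)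
  have hq : 0 < q := Real.sqrt_pos.2 hq2
  have hQ : √(1 + θ) / √(1 - θ) * μ = (1 + θ) * μ / q := by
    have : 0 < √(1 + θ) := Real.sqrt_pos.2 (by linarith)
    rw [hqe, div_mul_eq_mul_div, div_eq_div_iff (by positivity) (by positivity)]
    linear_combination √(1 - θ) * μ * hs2
  have hρ : θ * √(1 + θ) / √(1 - θ) * μ = θ * (√(1 + θ) / √(1 - θ) * μ) := by ring
  rw [hρ]
  set Q := √(1 + θ) / √(1 - θ) * μ
  have hA' : √2 * r / (q * q) ≤ Q := by
    rw [hQ, div_le_div_iff₀ (by positivity) hq]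
    nlinarith
  have hB : r / (q * (1 - θ)) + 1 / q ≤ 1 / ((1 - θ) * q) + Q := by
    have hr : r ≤ 1 + θ := Real.sqrt_le_iff.2 ⟨by linarith, by nlinarith⟩
    have hm : 1 ≤ (1 - θ) * μ := by
      have h2 : (1 - θ) * (1 / (1 - θ) ^ 2) ≤ (1 - θ) * μ := by gcongr
      refine le_trans ?_ h2
      have : (1 - θ) * (1 / (1 - θ) ^ 2) = 1 / (1 - θ) := by field_simp
      rw [this, le_div_iff₀ h1']
      linarith
    have e1 : r / (q * (1 - θ)) + 1 / q = (r + (1 - θ)) / (q * (1 - θ)) := by field_simp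
    have e2 : 1 / ((1 - θ) * q) + Q = (1 + (1 + θ) * ((1 - θ) * μ)) / (q * (1 - θ)) := by
      rw [hQ]
      field_simp
    rw [e1, e2]
    refine div_le_div_of_nonneg_right ?_ (by positivity)
    nlinarith
  have hQ0 : 0 ≤ Q := le_trans (by positivity) hA'
  have e : (r * (√2 * (θ * a + ν) / q + ν / (1 - θ)) + ν) / q + ν / (1 - θ) =
      √2 * r / (q * q) * (θ * a) + (1 / (1 - θ) + (r / (q * (1 - θ)) + 1 / q) +
        √2 * r / (q * q)) * ν := by
    field_simp
    ring
  rw [e]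
  have t1 : √2 * r / (q * q) * (θ * a) ≤ Q * (θ * a) := by gcongr
  have t2 : (1 / (1 - θ) + (r / (q * (1 - θ)) + 1 / q) + √2 * r / (q * q)) * ν ≤
      (1 / (1 - θ) + 1 / ((1 - θ) * q) + 2 * κ * Q) * ν := by
    refine mul_le_mul_of_nonneg_right ?_ hν
    have : Q ≤ κ * Q := le_mul_of_one_le_left hQ0 hκ
    linarith
  linarith

lemma rho_nonneg {alg : Alg} {θ : ℝ} (h0 : 0 ≤ θ) : 0 ≤ rho alg θ := by
  cases alg
  · simp only [rho]
    exact mul_nonneg (by positivity) (le_max_of_le_right (by positivity))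
  all_goals simp only [rho]; positivity

lemma rho_pos {alg : Alg} {θ : ℝ} (h0 : 0 < θ) (h1 : alg = .ObIHT ∨ θ < 1) :
    0 < rho alg θ := by
  cases alg
  case ObIHT => simpa [rho] using h0
  all_goals
    have h1 : θ < 1 := by simpa using h1
    have h1' : 0 < 1 - θ := by linarith
    have hq : 0 < 1 - θ ^ 2 := by nlinarith
    simp only [rho]
  · exact mul_pos (by positivity) (lt_max_of_lt_left (by positivity))
  · positivity
  · positivity

lemma rho_lt_one {alg : Alg} {θ : ℝ} (h0 : 0 ≤ θ) (h : θ < threshold alg) :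
    rho alg θ < 1 := by
  cases alg <;> simp only [rho, threshold] at h ⊢
  · have h1' : 0 < 1 - θ := by linarith
    have hX : (θ * √(1 + θ) / √(1 - θ)) ^ 2 = θ ^ 2 * (1 + θ) / (1 - θ) := by
      rw [div_pow, mul_pow, Real.sq_sqrt (by linarith), Real.sq_sqrt h1'.le]
    -- below, the branch `1 / (1 - θ) ^ 2` is the tight one: `θ ^ 2 (1 + θ) < (1 - θ) ^ 5`
    have hb : θ ^ 2 * (1 + θ) ≤ 0.325 ^ 2 * 1.325 := by
      gcongr
      linarith
    rcases max_choice (1 / (1 - θ) ^ 2) (2 / (1 + 2 * θ + 2 * θ ^ 2)) with hm | hm <;> rw [hm]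
    · rw [mul_one_div, div_lt_one (by positivity)]
      refine lt_of_pow_lt_pow_left₀ 2 (by positivity) ?_
      rw [hX, div_lt_iff₀ h1']
      have h5 : (0.675 : ℝ) ^ 5 ≤ (1 - θ) ^ 5 := pow_le_pow_left₀ (by norm_num) (by linarith) 5
      calc θ ^ 2 * (1 + θ) ≤ 0.325 ^ 2 * 1.325 := hb
        _ < 0.675 ^ 5 := by norm_num
        _ ≤ (1 - θ) ^ 5 := h5
        _ = ((1 - θ) ^ 2) ^ 2 * (1 - θ) := by ring
    · have h2 : θ * √(1 + θ) / √(1 - θ) < 1 / 2 := by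
        refine lt_of_pow_lt_pow_left₀ 2 (by norm_num) ?_
        rw [hX, div_lt_iff₀ h1']
        norm_num at hb
        linarith
      rw [← mul_div_assoc, div_lt_one (by positivity)]
      nlinarith
  · have hθ2 : θ ^ 2 ≤ 0.384 ^ 2 := pow_le_pow_left₀ h0 h.le 2
    rw [Real.sqrt_lt' one_pos, one_pow, div_lt_one (by norm_num at hθ2; linarith)]
    norm_num at hθ2
    nlinarith [sq_nonneg θ]
  · linarith
  · have hθ2 : θ ^ 2 ≤ 0.577 ^ 2 := pow_le_pow_left₀ h0 h.le 2
    norm_num at hθ2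
    rw [Real.sqrt_lt' one_pos, one_pow, div_lt_one (by linarith)]
    linarith

lemma tau_pos {𝕜 : Type*} [RCLike 𝕜] {m n : ℕ} {alg : Alg} {s : ℕ}
    {Ψ Ψt : Matrix (Fin m) (Fin n) 𝕜} (h1 : alg = .ObIHT ∨ theta alg s Ψ Ψt < 1) :
    0 < tau alg s Ψ Ψt := by
  have hr (k : ℕ) (A : Matrix (Fin m) (Fin n) 𝕜) : 0 < 1 + ric k A :=
    add_pos_of_pos_of_nonneg one_pos (ric_nonneg k A)
  have h0 : 0 ≤ theta alg s Ψ Ψt := rboc_nonneg _ _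
  have := hr s Ψ
  have := hr (2 * s) Ψt
  have := hr (4 * s) Ψt
  cases alg <;> simp only [tau]
  case ObIHT => positivity
  all_goals
    replace h1 := h1.resolve_left (by simp)
    have h1' := sub_pos.2 h1
    have hq := sub_pos.2 (pow_lt_one₀ h0 h1 two_ne_zero)
  · have hμ := lt_max_of_lt_left (c := 2 / (1 + 2 * theta .ObSP s Ψ Ψt +
      2 * theta .ObSP s Ψ Ψt ^ 2)) (one_div_pos.2 (pow_pos h1' 2))
    positivity
  · positivity
  · positivity

end Constants

/-! ### The recursion -/

section Recursion

variable {𝕜 : Type*} [RCLike 𝕜] {m n : ℕ}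

/-- Every iterate of `ObSP` solves a least squares problem on at most `s` indices. -/
lemma IsGenerated.exists_isObliqueLS {s : ℕ} {Ψ Ψt : Matrix (Fin m) (Fin n) 𝕜}
    {y : EuclideanSpace 𝕜 (Fin m)} {x : ℕ → EuclideanSpace 𝕜 (Fin n)}
    (h : IsGenerated .ObSP s Ψ Ψt y x) (t : ℕ) :
    ∃ J : Finset (Fin n), J.card ≤ s ∧ IsObliqueLS Ψ Ψt y J (x t) := by
  cases t with
  | zero => exact h.1
  | succ t =>
    obtain ⟨_, _, g, _, _, hg, hLS⟩ := h.2 t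
    exact ⟨supp g, hg.1, hLS⟩

lemma IsGenerated.isSparse {alg : Alg} {s : ℕ} {Ψ Ψt : Matrix (Fin m) (Fin n) 𝕜}
    {y : EuclideanSpace 𝕜 (Fin m)} {x : ℕ → EuclideanSpace 𝕜 (Fin n)}
    (h : IsGenerated alg s Ψ Ψt y x) (t : ℕ) : IsSparse s (x t) := by
  cases alg
  · obtain ⟨J, hJ, hLS⟩ := h.exists_isObliqueLS t
    exact (Finset.card_le_card hLS.1).trans hJ
  all_goals
    cases t with
    | zero => exact h.1
    | succ t => ?_
  · obtain ⟨_, _, _, _, hg⟩ := h.2 t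
    exact hg.1
  · exact (h.2 t : IsHardThreshold s _ _).1
  · obtain ⟨g, hg, hLS⟩ := h.2 t
    exact (Finset.card_le_card hLS.1).trans hg.1

lemma norm_succ_sub_le {alg : Alg} {s : ℕ} {Ψ Ψt : Matrix (Fin m) (Fin n) 𝕜}
    (h1 : alg = .ObIHT ∨ theta alg s Ψ Ψt < 1)
    {xs : EuclideanSpace 𝕜 (Fin n)} {y z : EuclideanSpace 𝕜 (Fin m)}
    {x : ℕ → EuclideanSpace 𝕜 (Fin n)} (hxs : IsSparse s xs) (hy : y = act Ψ xs + z)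
    (hx : IsGenerated alg s Ψ Ψt y x) (t : ℕ) :
    ‖x (t + 1) - xs‖ ≤ rho alg (theta alg s Ψ Ψt) * ‖x t - xs‖ + tau alg s Ψ Ψt * ‖z‖ := by
  have hsp := hx.isSparse t
  have hstep := hx.2 t
  have h0 : 0 ≤ theta alg s Ψ Ψt := rboc_nonneg _ _
  cases alg
  case ObIHT =>
    refine (ObIHT_step_le hy hxs hsp hstep).trans_eq ?_
    simp only [rho, tau, theta, order]
    ring
  all_goals replace h1 := h1.resolve_left (by simp)
  · obtain ⟨J₀, hJ₀, hLS⟩ := hx.exists_isObliqueLS t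
    have hs := ObSP_step_le hy hxs (θ := theta .ObSP s Ψ Ψt) rfl h1 rfl hJ₀ hLS hstep
    have hκ : 1 ≤ √(1 + ric s Ψ) * √(1 + ric (2 * s) Ψt) / (1 - theta .ObSP s Ψ Ψt) := by
      have a1 : 1 ≤ √(1 + ric s Ψ) := Real.one_le_sqrt.2 (by linarith [ric_nonneg s Ψ])
      have a2 : 1 ≤ √(1 + ric (2 * s) Ψt) :=
        Real.one_le_sqrt.2 (by linarith [ric_nonneg (2 * s) Ψt])
      rw [le_div_iff₀ (by linarith)]
      nlinarith
    refine (hs.trans (ObSP_constants_le h0 h1 (norm_nonneg _) (by positivity) hκ)).trans_eq ?_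
    simp only [tau]
    have e : √(1 + ric (2 * s) Ψt) ^ 2 = 1 + ric (2 * s) Ψt :=
      Real.sq_sqrt (by linarith [ric_nonneg (2 * s) Ψt])
    set θ := theta .ObSP s Ψ Ψt
    set μ := max (1 / (1 - θ) ^ 2) (2 / (1 + 2 * θ + 2 * θ ^ 2))
    rw [← e, Real.sqrt_sq (Real.sqrt_nonneg _)]
    have h1' : 0 < 1 - θ := by linarith
    have hs1 : 0 < √(1 - θ) := Real.sqrt_pos.2 h1'
    field_simp
  · refine (ObCoSaMP_step_le hy hxs hsp hstep (θ := theta .ObCoSaMP s Ψ Ψt) rfl h1 rfl).trans ?_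
    simp only [rho, tau]
    set θ := theta .ObCoSaMP s Ψ Ψt
    have hq : 0 ≤ 1 - θ ^ 2 := by nlinarith
    have e1 : √(2 * (1 + 3 * θ ^ 2) / (1 - θ ^ 2)) = √2 * √(1 + 3 * θ ^ 2) / √(1 - θ ^ 2) := by
      rw [Real.sqrt_div (by positivity), Real.sqrt_mul (by norm_num)]
    have e2 : √(4 * θ ^ 2 * (1 + 3 * θ ^ 2) / (1 - θ ^ 2)) =
        2 * θ * √(1 + 3 * θ ^ 2) / √(1 - θ ^ 2) := by
      rw [Real.sqrt_div (by positivity), Real.sqrt_mul (by positivity),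
        show 4 * θ ^ 2 = (2 * θ) ^ 2 by ring, Real.sqrt_sq (by positivity)]
    have h2 : √2 ≤ 2 := Real.sqrt_le_iff.2 ⟨by norm_num, by norm_num⟩
    have h3 : √2 * (θ * √(1 + 3 * θ ^ 2) / √(1 - θ ^ 2) * ‖x t - xs‖) ≤
        2 * (θ * √(1 + 3 * θ ^ 2) / √(1 - θ ^ 2) * ‖x t - xs‖) := by gcongr
    rw [e1, e2]
    refine le_of_sub_nonneg ?_
    refine (sub_nonneg.2 h3).trans_eq ?_
    ring
  · refine (ObHTP_step_le hy hxs hsp hstep (θ := theta .ObHTP s Ψ Ψt) rfl h1 rfl).trans_eq ?_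
    simp only [rho, tau]
    set θ := theta .ObHTP s Ψ Ψt
    rw [Real.sqrt_div (by positivity), Real.sqrt_div (by positivity),
      Real.sqrt_mul (by norm_num), Real.sqrt_sq h0]
    ring

end Recursion

end ObliquePursuit

theorem mainTheorem4 {𝕜 : Type*} [RCLike 𝕜] {m n : ℕ} (s : ℕ)
    (Ψ Ψt : Matrix (Fin m) (Fin n) 𝕜) (alg : ObliquePursuit.Alg) :
    -- the recursion, whenever the constants are defined
    ((alg = .ObIHT ∨ ObliquePursuit.theta alg s Ψ Ψt < 1) →
      0 ≤ ObliquePursuit.rho alg (ObliquePursuit.theta alg s Ψ Ψt) ∧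
      (ObliquePursuit.theta alg s Ψ Ψt ≠ 0 →
        0 < ObliquePursuit.rho alg (ObliquePursuit.theta alg s Ψ Ψt)) ∧
      0 < ObliquePursuit.tau alg s Ψ Ψt ∧
      ∀ (xstar : EuclideanSpace 𝕜 (Fin n)) (y z : EuclideanSpace 𝕜 (Fin m))
        (x : ℕ → EuclideanSpace 𝕜 (Fin n)),
        ObliquePursuit.IsSparse s xstar →
        y = ObliquePursuit.act Ψ xstar + z →
        ObliquePursuit.IsGenerated alg s Ψ Ψt y x →
        ∀ t : ℕ, ‖x (t + 1) - xstar‖ ≤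
          ObliquePursuit.rho alg (ObliquePursuit.theta alg s Ψ Ψt) * ‖x t - xstar‖
            + ObliquePursuit.tau alg s Ψ Ψt * ‖z‖) ∧
    -- the contraction condition
    (ObliquePursuit.theta alg s Ψ Ψt < ObliquePursuit.threshold alg →
      ObliquePursuit.rho alg (ObliquePursuit.theta alg s Ψ Ψt) < 1) := by
  have h0 : 0 ≤ ObliquePursuit.theta alg s Ψ Ψt := ObliquePursuit.rboc_nonneg _ _
  refine ⟨fun h1 => ⟨ObliquePursuit.rho_nonneg h0, fun hne =>
    ObliquePursuit.rho_pos (lt_of_le_of_ne h0 hne.symm) h1, ObliquePursuit.tau_pos h1, ?_⟩,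
    ObliquePursuit.rho_lt_one h0⟩
  intro xstar y z x hxs hy hx t
  exact ObliquePursuit.norm_succ_sub_le h1 hxs hy hx t
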